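/- Let $\bar x>0$, let $\Omega=[0,\bar x]\times[0,\infty)$ be the playing field and $G=[0,\bar x]\times\{0\}$ the goal line. An evader $E$ and two pursuers $P_1,P_2$ start on $\Omega$ and move with the same constant speed $v>0$, each controlling its heading (a measurable function of time with values in $[-\pi,\pi]$). The evader wins if it arrives on $G$ without having left $\Omega$ and without having coincided with a pursuer up to and including the time of arrival; otherwise the pursuers win. Both teams use non-anticipative strategies: the headings at time $t$ depend only on the opponents' headings before time $t$; a strategy of the evader is admitted if it produces a play against every strategy of the pursuers. Let $\mathcal R_e\subset\Omega^3$ (respectively $\mathcal R_p\subset\Omega^3$) be the set of initial states $(E,P_1,P_2)$ from which the evader (respectively the pursuer team) has a strategy that wins against all controls of the opponent, and let the Barrier surface be the common boundary of $\mathcal R_e$ and $\mathcal R_p$ relative to $\Omega^3$. Fix pursuer positions $P_1=(x_1,y_1)$, $P_2=(x_2,y_2)$ in $\Omega$ with $x_1<x_2$, and suppose that the point $(x_I,0)$ in which the perpendicular bisector of $P_1P_2$ meets the $x$-axis, $x_I=\frac12\,\frac{x_2^2+y_2^2-x_1^2-y_1^2}{x_2-x_1}$, lies on the goal line, i.e.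 $0\le x_I\le\bar x$. Then the cross-section of the Barrier surface in the evader's plane, i.e. the set of all $(x,y)$ such that $((x,y),P_1,P_2)$ is on the Barrier surface, consists of arcs of three circles: it is exactly the set of all $(x,y)\in\Omega$ that satisfy $$\begin{aligned} x^2+y^2&=x_1^2+y_1^2 &&\text{if } x\le x_1,\\ (x-x_I)^2+y^2&=(x_1-x_I)^2+y_1^2 &&\text{if } x_1<x<x_2,\\ (x-\bar x)^2+y^2&=(x_2-\bar x)^2+y_2^2 &&\text{if } x\ge x_2. \end{aligned}$$ -/

import Mathlib

namespace FootballGame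

/-- A position in the plane. -/
abbrev Point : Type := ℝ × ℝ

/-- A state `(E, P₁, P₂)` of the game, an element of `ℝ⁶`. -/
abbrev State : Type := Point × Point × Point

/-- The playing field `Ω = [0, L] × [0, ∞)`. -/
def field (L : ℝ) : Set Point := {p | 0 ≤ p.1 ∧ p.1 ≤ L ∧ 0 ≤ p.2}

/-- The goal line: the points of the field with zero ordinate. -/
def goalLine (L : ℝ) : Set Point := {p | p ∈ field L ∧ p.2 = 0}

/-- The states in which all three players stand on the field. -/
def stateSpace (L : ℝ) : Set State :=
  {s | s.1 ∈ field L ∧ s.2.1 ∈ field L ∧ s.2.2 ∈ field L}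

/-- An admissible control: a measurable heading angle in `[-π, π]` as a function of time
(only the times `t ≥ 0` matter). -/
def IsControl (φ : ℝ → ℝ) : Prop :=
  Measurable φ ∧ ∀ t, φ t ∈ Set.Icc (-Real.pi) Real.pi

/-- The motion from `p` with speed `v` and heading `φ`: the (Carathéodory) solution of
`x' = v cos φ`, `y' = v sin φ` with initial value `p`. -/
noncomputable def motion (v : ℝ) (p : Point) (φ : ℝ → ℝ) (t : ℝ) : Point :=
  (p.1 + ∫ τ in (0 : ℝ)..t, v * Real.cos (φ τ), p.2 + ∫ τ in (0 : ℝ)..t, v * Real.sin (φ τ))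

/-- From the initial state `s`, under the headings `φ`, `ψ₁`, `ψ₂`, the evader arrives on the goal
line at some time `T`, without having left the field and without having been captured by either
pursuer (point capture) up to and including time `T`. -/
def EvaderScores (vE v₁ v₂ L : ℝ) (s : State) (φ ψ₁ ψ₂ : ℝ → ℝ) : Prop :=
  ∃ T : ℝ, 0 ≤ T ∧ motion vE s.1 φ T ∈ goalLine L ∧
    ∀ t ∈ Set.Icc 0 T, motion vE s.1 φ t ∈ field L ∧
      motion vE s.1 φ t ≠ motion v₁ s.2.1 ψ₁ t ∧
      motion vE s.1 φ t ≠ motion v₂ s.2.2 ψ₂ t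

/-- A non-anticipative strategy of the pursuer team: it answers the heading of the evader with a
pair of headings whose values at time `t` depend only on the evader's heading at the times
before `t`. -/
def IsPursuerStrategy (β₁ β₂ : (ℝ → ℝ) → ℝ → ℝ) : Prop :=
  (∀ φ, IsControl φ → IsControl (β₁ φ) ∧ IsControl (β₂ φ)) ∧
  ∀ φ φ', IsControl φ → IsControl φ' →
    ∀ t : ℝ, 0 ≤ t → (∀ τ ∈ Set.Ico 0 t, φ τ = φ' τ) →
      β₁ φ t = β₁ φ' t ∧ β₂ φ t = β₂ φ' t

/-- A non-anticipative strategy of the evader: it answers the headings of the two pursuers with a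
heading whose value at time `t` depends only on the pursuers' headings at the times before `t`.
As usual, only strategies that produce a play against every strategy of the opponent are admitted:
for all strategies `β₁, β₂` of the pursuer team there is a heading `φ` of the evader that is its
answer to the pursuers' answers to `φ`. Every fixed heading, and every strategy with a positive
reaction time, has this property. -/
def IsEvaderStrategy (α : (ℝ → ℝ) → (ℝ → ℝ) → ℝ → ℝ) : Prop :=
  (∀ ψ₁ ψ₂, IsControl ψ₁ → IsControl ψ₂ → IsControl (α ψ₁ ψ₂)) ∧
  (∀ ψ₁ ψ₂ ψ₁' ψ₂', IsControl ψ₁ → IsControl ψ₂ → IsControl ψ₁' → IsControl ψ₂' →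
    ∀ t : ℝ, 0 ≤ t → (∀ τ ∈ Set.Ico 0 t, ψ₁ τ = ψ₁' τ ∧ ψ₂ τ = ψ₂' τ) →
      α ψ₁ ψ₂ t = α ψ₁' ψ₂' t) ∧
  ∀ β₁ β₂, IsPursuerStrategy β₁ β₂ →
    ∃ φ, IsControl φ ∧ ∀ t : ℝ, 0 ≤ t → α (β₁ φ) (β₂ φ) t = φ t

/-- The winning set of the evader: the initial states from which the evader has a strategy that
brings it to the goal line uncaptured, whatever the pursuers do. -/
def evaderWinSet (vE v₁ v₂ L : ℝ) : Set State :=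
  {s | s ∈ stateSpace L ∧ ∃ α, IsEvaderStrategy α ∧
    ∀ ψ₁ ψ₂, IsControl ψ₁ → IsControl ψ₂ → EvaderScores vE v₁ v₂ L s (α ψ₁ ψ₂) ψ₁ ψ₂}

/-- The winning set of the pursuer team: the initial states from which the pursuers have a strategy
that keeps the evader from arriving on the goal line uncaptured, whatever the evader does. -/
def pursuerWinSet (vE v₁ v₂ L : ℝ) : Set State :=
  {s | s ∈ stateSpace L ∧ ∃ β₁ β₂, IsPursuerStrategy β₁ β₂ ∧
    ∀ φ, IsControl φ → ¬ EvaderScores vE v₁ v₂ L s φ (β₁ φ) (β₂ φ)}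

/-- The Barrier surface, which separates the two winning sets: the states on the common boundary of
the two winning sets, relative to the set of all states. -/
def barrier (vE v₁ v₂ L : ℝ) : Set State :=
  {s | ∃ h : s ∈ stateSpace L,
    (⟨s, h⟩ : stateSpace L) ∈ frontier (Subtype.val ⁻¹' evaderWinSet vE v₁ v₂ L) ∧
    (⟨s, h⟩ : stateSpace L) ∈ frontier (Subtype.val ⁻¹' pursuerWinSet vE v₁ v₂ L)}

/-- The cross-section of the Barrier surface in the evader's plane for the pursuers' positions
`P₁` and `P₂`. -/
def barrierCrossSection (vE v₁ v₂ L : ℝ) (P₁ P₂ : Point) : Set Point :=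
  {p | (p, P₁, P₂) ∈ barrier vE v₁ v₂ L}

/-- The abscissa `x_I` of the point where the perpendicular bisector of the segment `P₁P₂` meets
the `x`-axis (for pursuers with different abscissas). -/
noncomputable def xI (P₁ P₂ : Point) : ℝ :=
  1 / 2 * ((P₂.1 ^ 2 + P₂.2 ^ 2 - P₁.1 ^ 2 - P₁.2 ^ 2) / (P₂.1 - P₁.1))

end FootballGame

/-! Let the gap at a goal point be the squared distance of the evader to it minus that of a pursuer.
If at every goal point some gap is positive, the pursuers win: each mirrors the evader in their
initial perpendicular bisector, and an evader heading for a point nearer to a pursuer must cross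
that bisector, where the two meet (`exists_capture_of_gap_pos`). If at some goal point both gaps are
negative, the evader wins by running straight there.

These two conditions are open, and a state satisfying neither is a limit of states of both kinds. As
the winning sets are disjoint, the Barrier consists exactly of the states satisfying neither
(`mem_barrier_iff`), that is, those where the larger gap has minimum 0 over the goal line. Gaps are
affine along that line, so the minimum lies at its left end, at `xI` or at its right end, according
to the evader's abscissa; its vanishing is the equation of the circle. -/

namespace FootballGame

open MeasureTheory Complex Set

/-! ### Motions as complex integrals -/

/-- The position `p` as a complex number. -/
def toComplex (p : Point) : ℂ := ⟨p.1, p.2⟩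

theorem toComplex_injective : Function.Injective toComplex := fun _ _ h =>
  Prod.ext (congrArg Complex.re h) (congrArg Complex.im h)

/-- The unit vector with heading `φ t`. -/
noncomputable def heading (φ : ℝ → ℝ) (t : ℝ) : ℂ := exp (φ t * I)

theorem norm_heading (φ : ℝ → ℝ) (t : ℝ) : ‖heading φ t‖ = 1 := norm_exp_ofReal_mul_I _

theorem measurable_heading {φ : ℝ → ℝ} (h : Measurable φ) : Measurable (heading φ) := by
  unfold heading
  fun_prop

theorem locallyIntegrable_heading {φ : ℝ → ℝ} (h : Measurable φ) :
    LocallyIntegrable (heading φ) :=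
  (locallyIntegrable_const (1 : ℝ)).mono (measurable_heading h).aestronglyMeasurable
    (Filter.Eventually.of_forall fun t => by simp [norm_heading])

theorem intervalIntegrable_heading {φ : ℝ → ℝ} (h : Measurable φ) (a b : ℝ) :
    IntervalIntegrable (heading φ) volume a b :=
  ((locallyIntegrable_heading h).integrableOn_isCompact isCompact_uIcc).intervalIntegrable

theorem toComplex_motion (v : ℝ) (p : Point) {φ : ℝ → ℝ} (h : Measurable φ) (t : ℝ) :
    toComplex (motion v p φ t) = toComplex p + v * ∫ τ in (0 : ℝ)..t, heading φ τ := by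
  have hi := intervalIntegrable_heading h 0 t
  have hre : (∫ τ in (0 : ℝ)..t, heading φ τ).re = ∫ τ in (0 : ℝ)..t, Real.cos (φ τ) := by
    rw [← reCLM_apply, ← reCLM.intervalIntegral_comp_comm hi]
    simp [heading, exp_ofReal_mul_I_re]
  have him : (∫ τ in (0 : ℝ)..t, heading φ τ).im = ∫ τ in (0 : ℝ)..t, Real.sin (φ τ) := by
    rw [← imCLM_apply, ← imCLM.intervalIntegral_comp_comm hi]
    simp [heading, exp_ofReal_mul_I_im]
  apply Complex.ext
  · simp [toComplex, motion, hre]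
  · simp [toComplex, motion, him]

theorem norm_integral_heading_le (φ : ℝ → ℝ) {t : ℝ} (ht : 0 ≤ t) :
    ‖∫ τ in (0 : ℝ)..t, heading φ τ‖ ≤ t := by
  simpa [abs_of_nonneg ht] using
    intervalIntegral.norm_integral_le_of_norm_le_const (a := 0) (b := t) (C := 1)
      fun τ _ => (norm_heading φ τ).le

/-! ### Recovering the evader's velocity from its strict past -/

/-- The path with heading `φ` from the origin with unit speed, at rest before time `0`. -/
noncomputable def unitPath (φ : ℝ → ℝ) (t : ℝ) : ℂ :=
  ∫ τ in (0 : ℝ)..t, (Ici (0 : ℝ)).indicator (heading φ) τ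

/-- The velocity of `unitPath φ`, computed from the past of the path. -/
noncomputable def pastVelocity (φ : ℝ → ℝ) (t : ℝ) : ℂ :=
  -derivWithin (fun s => unitPath φ (-s)) (Ici (-t)) (-t)

theorem measurable_pastVelocity (φ : ℝ → ℝ) : Measurable (pastVelocity φ) :=
  ((measurable_derivWithin_Ici _).comp measurable_neg).neg

theorem unitPath_congr {φ φ' : ℝ → ℝ} {t s : ℝ} (ht : 0 ≤ t)
    (h : ∀ τ ∈ Ico 0 t, φ τ = φ' τ) (hs : s ≤ t) : unitPath φ s = unitPath φ' s := by
  refine intervalIntegral.integral_congr_ae ?_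
  -- The heading at time `t` itself is not controlled, but a single instant is null. Negative times
  -- do not matter because of the indicator.
  filter_upwards [compl_mem_ae_iff.2 (measure_singleton t)] with τ hτ hmem
  have hle : τ ≤ t := hmem.2.trans (max_le ht hs)
  have hlt : τ < t := lt_of_le_of_ne hle hτ
  by_cases h0 : 0 ≤ τ
  · simp [indicator, h0, heading, h τ ⟨h0, hlt⟩]
  · simp [indicator, h0]

theorem pastVelocity_congr {φ φ' : ℝ → ℝ} {t : ℝ} (ht : 0 ≤ t)
    (h : ∀ τ ∈ Ico 0 t, φ τ = φ' τ) : pastVelocity φ t = pastVelocity φ' t := by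
  exact congrArg Neg.neg (derivWithin_congr
    (fun s hs => unitPath_congr ht h (neg_le.1 (mem_Ici.1 hs)))
    (unitPath_congr ht h (neg_neg t).le))

/-- Lebesgue differentiation. A pursuer may not use the current heading of the evader, but the left
derivative of the path recovers it at almost every time, which is enough for integrals. -/
theorem pastVelocity_ae_eq {φ : ℝ → ℝ} (hφ : Measurable φ) :
    ∀ᵐ t, 0 ≤ t → pastVelocity φ t = heading φ t := by
  have hint : LocallyIntegrable ((Ici (0 : ℝ)).indicator (heading φ)) :=
    (locallyIntegrable_heading hφ).indicator measurableSet_Ici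
  filter_upwards [LocallyIntegrable.ae_hasDerivAt_integral hint] with t ht h0
  have h1 : HasDerivAt (unitPath φ) (heading φ t) (-(-t)) := by
    have := ht 0
    rw [indicator_of_mem (mem_Ici.2 h0)] at this
    rwa [neg_neg]
  have h2 := (h1.scomp (-t) (hasDerivAt_neg (-t))).hasDerivWithinAt (s := Ici (-t))
  have h3 := h2.derivWithin (uniqueDiffOn_Ici _ _ self_mem_Ici)
  simp only [Function.comp_def] at h3
  simp [pastVelocity, h3]

/-! ### The mirror strategy -/

/-- The heading of a pursuer that mirrors the velocity of the evader at the perpendicular bisector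
of the two players, where `n` is the initial position of the evader relative to the pursuer. -/
noncomputable def mirrorHeading (n : ℂ) (φ : ℝ → ℝ) (t : ℝ) : ℝ :=
  arg (-(n / star n) * star (pastVelocity φ t))

theorem isControl_mirrorHeading (n : ℂ) (φ : ℝ → ℝ) : IsControl (mirrorHeading n φ) := by
  refine ⟨?_, fun t => ⟨(neg_pi_lt_arg _).le, arg_le_pi _⟩⟩
  refine measurable_arg.comp (Measurable.const_mul ?_ _)
  exact continuous_star.measurable.comp (measurable_pastVelocity φ)

theorem isPursuerStrategy_mirrorHeading (n₁ n₂ : ℂ) :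
    IsPursuerStrategy (mirrorHeading n₁) (mirrorHeading n₂) := by
  refine ⟨fun φ _ => ⟨isControl_mirrorHeading _ φ, isControl_mirrorHeading _ φ⟩,
    fun φ φ' _ _ t ht h => ?_⟩
  simp [mirrorHeading, pastVelocity_congr ht h]

/-- The map `z ↦ -(n / star n) * star z` is the reflection that sends `n` to `-n`. It is real
linear, so it commutes with the integral, and it preserves unit vectors, so `arg` loses nothing. -/
theorem integral_heading_mirrorHeading {n : ℂ} (hn : n ≠ 0) {φ : ℝ → ℝ} (hφ : Measurable φ)
    {t : ℝ} (ht : 0 ≤ t) :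
    ∫ τ in (0 : ℝ)..t, heading (mirrorHeading n φ) τ =
      -(n / star n) * star (∫ τ in (0 : ℝ)..t, heading φ τ) := by
  have hstar : star (∫ τ in (0 : ℝ)..t, heading φ τ) =
      ∫ τ in (0 : ℝ)..t, star (heading φ τ) :=
    (conjCLE.toContinuousLinearMap.intervalIntegral_comp_comm
      (intervalIntegrable_heading hφ 0 t)).symm
  rw [hstar, ← intervalIntegral.integral_const_mul]
  refine intervalIntegral.integral_congr_ae ?_
  filter_upwards [pastVelocity_ae_eq hφ] with τ hτ hmem
  rw [uIoc_of_le ht] at hmem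
  have hnorm : ‖-(n / star n) * star (heading φ τ)‖ = 1 := by
    simp [norm_heading, hn]
  have := norm_mul_exp_arg_mul_I (-(n / star n) * star (heading φ τ))
  rw [hnorm, ofReal_one, one_mul] at this
  rw [heading, mirrorHeading, hτ hmem.1.le, this]

/-- The squared distance of `e` from `(s, 0)` minus that of `p`. -/
def gap (e p : Point) (s : ℝ) : ℝ :=
  ((e.1 - s) ^ 2 + e.2 ^ 2) - ((p.1 - s) ^ 2 + p.2 ^ 2)

theorem normSq_toComplex_sub (p : Point) (s : ℝ) :
    ‖toComplex p - s‖ ^ 2 = (p.1 - s) ^ 2 + p.2 ^ 2 := by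
  rw [← normSq_eq_norm_sq, normSq_apply]
  simp [toComplex]
  ring

theorem gap_eq (e p : Point) (s : ℝ) :
    gap e p s = ‖toComplex e - s‖ ^ 2 - ‖toComplex p - s‖ ^ 2 := by
  rw [normSq_toComplex_sub, normSq_toComplex_sub, gap]

/-- A mirroring pursuer captures the evader before it reaches a point to which the pursuer is
closer. -/
theorem exists_capture_of_gap_pos {v : ℝ} {e p : Point} {s : ℝ} (hgap : 0 < gap e p s)
    {φ : ℝ → ℝ} (hφ : IsControl φ) {T : ℝ} (hT : 0 ≤ T) (hs : motion v e φ T = (s, 0)) :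
    ∃ t ∈ Icc 0 T, motion v e φ t =
      motion v p (mirrorHeading (toComplex e - toComplex p) φ) t := by
  set n := toComplex e - toComplex p with hn_def
  have hn : n ≠ 0 := by
    intro h
    rw [gap_eq, sub_eq_zero.1 h] at hgap
    simp at hgap
  set d : ℝ → ℂ := fun t => v * ∫ τ in (0 : ℝ)..t, heading φ τ with hd
  -- Up to a positive factor, `f` is the signed distance of the evader from the initial
  -- perpendicular bisector, positive on the evader's side.
  set f : ℝ → ℝ := fun t => 1 + 2 * (d t / n).re with hf
  have hcont : Continuous f := by
    have : Continuous d := continuous_const.mul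
      (intervalIntegral.continuous_primitive (fun a b => intervalIntegrable_heading hφ.1 a b) 0)
    exact continuous_const.add (continuous_const.mul (continuous_re.comp (this.div_const n)))
  have hf0 : f 0 = 1 := by simp [hf, hd]
  have hdT : toComplex e + d T = s := by
    rw [hd, ← toComplex_motion v e hφ.1 T, hs]
    rfl
  have hfT : f T < 0 := by
    have hN : 0 < normSq n := normSq_pos.2 hn
    have key : normSq n * f T = -gap e p s := by
      have h1 : d T = s - toComplex e := by rw [← hdT]; ring
      have h2 : (d T / n).re * normSq n = (d T).re * n.re + (d T).im * n.im := by
        rw [div_re]; field_simp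
      have h3 : normSq n * f T = normSq n + 2 * ((d T / n).re * normSq n) := by
        simp only [hf]; ring
      rw [h3, h2, h1, normSq_apply, hn_def, gap]
      simp [toComplex]
      ring
    nlinarith
  obtain ⟨t, ht, hft⟩ := intermediate_value_Icc' hT hcont.continuousOn
    (show (0 : ℝ) ∈ Icc (f T) (f 0) from ⟨hfT.le, by rw [hf0]; norm_num⟩)
  refine ⟨t, ht, toComplex_injective ?_⟩
  have hsn : star n ≠ 0 := star_ne_zero.2 hn
  rw [toComplex_motion v e hφ.1, toComplex_motion v p (isControl_mirrorHeading n φ).1,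
    integral_heading_mirrorHeading hn hφ.1 ht.1]
  have hsum : d t / n + star (d t / n) = ((2 * (d t / n).re : ℝ) : ℂ) := add_conj _
  have hzero : (1 : ℂ) + (d t / n + star (d t / n)) = 0 := by
    rw [hsum, ← ofReal_one, ← ofReal_add, show 1 + 2 * (d t / n).re = 0 from hft, ofReal_zero]
  have hdstar : star (d t) = v * star (∫ τ in (0 : ℝ)..t, heading φ τ) := by
    simp [hd]
  -- The left side is evader minus mirrored pursuer; it equals `n * f t`, so the two coincide on the
  -- bisector.
  have hmul : n + d t + n / star n * star (d t) = 0 := by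
    have : n + d t + n / star n * star (d t) = n * (1 + (d t / n + star (d t / n))) := by
      rw [star_div₀]
      field_simp
      ring
    rw [this, hzero, mul_zero]
  rw [hdstar] at hmul
  linear_combination hmul + hn_def

/-! ### Sufficient conditions for winning, and disjointness of the winning sets -/

/-- The states from which a pursuer is closer than the evader to each point of the goal line. -/
def guardedStates (L : ℝ) : Set State :=
  {w | ∀ s ∈ Icc 0 L, 0 < gap w.1 w.2.1 s ∨ 0 < gap w.1 w.2.2 s}

/-- The states from which the evader is closer than both pursuers to a point of the goal line. -/
def unguardedStates (L : ℝ) : Set State :=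
  {w | ∃ s ∈ Icc 0 L, gap w.1 w.2.1 s < 0 ∧ gap w.1 w.2.2 s < 0}

theorem guardedStates_subset_pursuerWinSet {v L : ℝ} {w : State} (hw : w ∈ stateSpace L)
    (h : w ∈ guardedStates L) : w ∈ pursuerWinSet v v v L := by
  refine ⟨hw, _, _, isPursuerStrategy_mirrorHeading (toComplex w.1 - toComplex w.2.1)
    (toComplex w.1 - toComplex w.2.2), ?_⟩
  rintro φ hφ ⟨T, hT, hgoal, hfree⟩
  have hs : motion v w.1 φ T = ((motion v w.1 φ T).1, 0) := Prod.ext rfl hgoal.2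
  rcases h _ ⟨hgoal.1.1, hgoal.1.2.1⟩ with h | h
  · obtain ⟨t, ht, hcap⟩ := exists_capture_of_gap_pos h hφ hT hs
    exact (hfree t ht).2.1 hcap
  · obtain ⟨t, ht, hcap⟩ := exists_capture_of_gap_pos h hφ hT hs
    exact (hfree t ht).2.2 hcap

theorem isEvaderStrategy_const {φ : ℝ → ℝ} (hφ : IsControl φ) :
    IsEvaderStrategy fun _ _ => φ :=
  ⟨fun _ _ _ _ => hφ, fun _ _ _ _ _ _ _ _ _ _ _ => rfl, fun _ _ _ => ⟨φ, hφ, fun _ _ => rfl⟩⟩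

theorem isControl_const_arg (z : ℂ) : IsControl fun _ => arg z :=
  ⟨measurable_const, fun _ => ⟨(neg_pi_lt_arg _).le, arg_le_pi _⟩⟩

theorem toComplex_motion_const_arg (v : ℝ) (e : Point) (z : ℂ) (t : ℝ) :
    ‖z‖ * toComplex (motion v e (fun _ => arg z) t) = ‖z‖ * toComplex e + v * t * z := by
  rw [toComplex_motion v e measurable_const]
  have : ∫ τ in (0 : ℝ)..t, heading (fun _ => arg z) τ = t * exp (arg z * I) := by
    simp [heading]
  rw [this]
  linear_combination (v * t : ℂ) * norm_mul_exp_arg_mul_I z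

/-- A player that runs straight to a point is not captured by a player that is farther from it. -/
theorem motion_ne_of_gap_neg {v : ℝ} (hv : 0 < v) {e p : Point} {s : ℝ} (hgap : gap e p s < 0)
    {φ ψ : ℝ → ℝ} (hψ : Measurable ψ) {t : ℝ} (ht : 0 ≤ t)
    (hdist : ‖toComplex (motion v e φ t) - s‖ + v * t ≤ ‖toComplex e - s‖) :
    motion v e φ t ≠ motion v p ψ t := by
  intro h
  -- A meeting at time `t` would put the pursuer's start within `v * t` of the meeting point, hence
  -- no farther from `s` than the evader's start.
  rw [gap_eq, sub_neg] at hgap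
  have hlt := lt_of_pow_lt_pow_left₀ 2 (norm_nonneg _) hgap
  rw [h, toComplex_motion v p hψ] at hdist
  have h1 := norm_integral_heading_le ψ ht
  have h2 : toComplex p - s = (toComplex p + v * (∫ τ in (0 : ℝ)..t, heading ψ τ) - s) -
      v * (∫ τ in (0 : ℝ)..t, heading ψ τ) := by ring
  have h3 := norm_sub_le (toComplex p + v * (∫ τ in (0 : ℝ)..t, heading ψ τ) - s)
    (v * (∫ τ in (0 : ℝ)..t, heading ψ τ))
  rw [← h2, norm_mul, norm_real, Real.norm_of_nonneg hv.le] at h3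
  nlinarith

theorem unguardedStates_subset_evaderWinSet {v L : ℝ} (hv : 0 < v) {w : State}
    (hw : w ∈ stateSpace L) (h : w ∈ unguardedStates L) : w ∈ evaderWinSet v v v L := by
  obtain ⟨s, hs, h1, h2⟩ := h
  obtain ⟨⟨e, p₁, p₂⟩, hw_def⟩ : ∃ w', w' = w := ⟨w, rfl⟩
  subst hw_def
  set z : ℂ := s - toComplex e with hz
  have hφ := isControl_const_arg z
  refine ⟨hw, fun _ _ => fun _ => arg z, isEvaderStrategy_const hφ, fun ψ₁ ψ₂ hψ₁ hψ₂ => ?_⟩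
  have hT : 0 ≤ ‖z‖ / v := by positivity
  have hpos : ∀ t ∈ Icc 0 (‖z‖ / v), ∃ c ∈ Icc (0 : ℝ) 1, v * t = c * ‖z‖ ∧
      toComplex (motion v e (fun _ => arg z) t) = toComplex e + c * z := by
    intro t ht
    have hle : v * t ≤ ‖z‖ := by
      have := (le_div_iff₀ hv).1 ht.2
      linarith
    have hvt : 0 ≤ v * t := mul_nonneg hv.le ht.1
    -- If the evader already stands at the target, the run takes no time and its heading is
    -- irrelevant.
    by_cases h0 : z = 0
    · have ht0 : t = 0 := by
        rw [h0, norm_zero] at hle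
        nlinarith [ht.1]
      refine ⟨0, by simp, by simp [ht0], ?_⟩
      rw [ht0, toComplex_motion v e measurable_const]
      simp
    · have hz0 : 0 < ‖z‖ := norm_pos_iff.2 h0
      refine ⟨v * t / ‖z‖, ⟨by positivity, (div_le_one hz0).2 hle⟩, by field_simp, ?_⟩
      have := toComplex_motion_const_arg v e z t
      have hzc : (‖z‖ : ℂ) ≠ 0 := ofReal_ne_zero.2 hz0.ne'
      apply mul_left_cancel₀ hzc
      rw [this]
      push_cast
      field_simp
  refine ⟨‖z‖ / v, hT, ?_, fun t ht => ?_⟩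
  · have hm : motion v e (fun _ => arg z) (‖z‖ / v) = (s, 0) := by
      apply toComplex_injective
      rw [toComplex_motion v e measurable_const]
      have h := norm_mul_exp_arg_mul_I z
      have hvc : (v : ℂ) ≠ 0 := ofReal_ne_zero.2 hv.ne'
      have : ∫ τ in (0 : ℝ)..(‖z‖ / v), heading (fun _ => arg z) τ =
          (‖z‖ / v : ℝ) * exp (arg z * I) := by
        simp [heading]
      rw [this, ← mul_assoc, ← ofReal_mul, mul_div_cancel₀ _ hv.ne', h, hz]
      simp only [add_sub_cancel]
      rfl
    simp only at hm ⊢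
    rw [hm]
    exact ⟨⟨hs.1, hs.2, le_rfl⟩, rfl⟩
  · obtain ⟨c, hc, hvt, hpt⟩ := hpos t ht
    have hdist : ‖toComplex (motion v e (fun _ => arg z) t) - s‖ + v * t ≤ ‖toComplex e - s‖ := by
      have : toComplex e + c * z - s = ((c - 1 : ℝ) : ℂ) * z := by
        rw [hz]; push_cast; ring
      rw [hpt, this, norm_mul, norm_real, Real.norm_of_nonpos (by linarith [hc.2]), hvt,
        norm_sub_rev (toComplex e)]
      apply le_of_eq
      rw [← hz]
      ring
    refine ⟨?_, motion_ne_of_gap_neg hv h1 hψ₁.1 ht.1 hdist,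
      motion_ne_of_gap_neg hv h2 hψ₂.1 ht.1 hdist⟩
    have hre : (motion v e (fun _ => arg z) t).1 = e.1 + c * (s - e.1) := by
      have := congrArg Complex.re hpt
      simpa [toComplex, hz] using this
    have him : (motion v e (fun _ => arg z) t).2 = e.2 + c * (0 - e.2) := by
      have := congrArg Complex.im hpt
      simpa [toComplex, hz] using this
    obtain ⟨hc0, hc1⟩ := hc
    obtain ⟨⟨he0, heL, hey⟩, -, -⟩ := hw
    simp only at he0 heL hey
    refine ⟨?_, ?_, ?_⟩
    · rw [hre]; nlinarith [hs.1]
    · rw [hre]; nlinarith [hs.2]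
    · rw [him]; nlinarith

theorem motion_congr {v : ℝ} {p : Point} {φ φ' : ℝ → ℝ} (h : ∀ t, 0 ≤ t → φ t = φ' t) {t : ℝ}
    (ht : 0 ≤ t) : motion v p φ t = motion v p φ' t := by
  have h' : ∀ τ ∈ uIcc 0 t, φ τ = φ' τ := fun τ hτ => by
    rw [uIcc_of_le ht] at hτ
    exact h τ hτ.1
  unfold motion
  rw [intervalIntegral.integral_congr fun τ hτ => by simp only [h' τ hτ]; rfl,
    intervalIntegral.integral_congr (f := fun τ => v * Real.sin (φ τ))
      (g := fun τ => v * Real.sin (φ' τ)) fun τ hτ => by simp only [h' τ hτ]]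

/-- Two winning strategies could be played against each other: the admissibility clause for the
evader supplies a heading consistent with both, up to its values at negative times. -/
theorem disjoint_winSets (vE v₁ v₂ L : ℝ) :
    Disjoint (evaderWinSet vE v₁ v₂ L) (pursuerWinSet vE v₁ v₂ L) := by
  rw [Set.disjoint_left]
  rintro w ⟨-, α, hα, hwin⟩ ⟨-, β₁, β₂, hβ, hlose⟩
  obtain ⟨φ, hφ, hplay⟩ := hα.2.2 β₁ β₂ hβ
  obtain ⟨T, hT, hgoal, hfree⟩ := hwin _ _ (hβ.1 φ hφ).1 (hβ.1 φ hφ).2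
  refine hlose φ hφ ⟨T, hT, ?_, fun t ht => ?_⟩
  · rwa [← motion_congr hplay hT]
  · rw [← motion_congr hplay ht.1]
    exact hfree t ht

/-! ### Topology of the two conditions and the Barrier -/

theorem isOpen_unguardedStates (L : ℝ) : IsOpen (unguardedStates L) := by
  have : unguardedStates L =
      ⋃ s ∈ Icc 0 L, {w : State | gap w.1 w.2.1 s < 0 ∧ gap w.1 w.2.2 s < 0} := by
    ext w
    simp [unguardedStates, and_left_comm, and_comm, and_assoc]
  rw [this]
  refine isOpen_biUnion fun s _ => ?_
  have h₁ : Continuous fun w : State => gap w.1 w.2.1 s := by unfold gap; fun_prop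
  have h₂ : Continuous fun w : State => gap w.1 w.2.2 s := by unfold gap; fun_prop
  exact (isOpen_lt h₁ continuous_const).inter (isOpen_lt h₂ continuous_const)

/-- The condition is open in state and goal point jointly; compactness of `[0, L]` makes it uniform.
-/
theorem isOpen_guardedStates (L : ℝ) : IsOpen (guardedStates L) := by
  rw [isOpen_iff_eventually]
  intro w hw
  refine isCompact_Icc.eventually_forall_of_forall_eventually fun s hs => ?_
  have hopen : IsOpen {q : State × ℝ | 0 < gap q.1.1 q.1.2.1 q.2 ∨ 0 < gap q.1.1 q.1.2.2 q.2} := by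
    have h₁ : Continuous fun q : State × ℝ => gap q.1.1 q.1.2.1 q.2 := by unfold gap; fun_prop
    have h₂ : Continuous fun q : State × ℝ => gap q.1.1 q.1.2.2 q.2 := by unfold gap; fun_prop
    exact (isOpen_lt continuous_const h₁).union (isOpen_lt continuous_const h₂)
  exact hopen.mem_nhds (hw s hs)

/-- The point `p` moved up by `ε`. -/
def raise (p : Point) (ε : ℝ) : Point := (p.1, p.2 + ε)

theorem raise_mem_field {L : ℝ} {p : Point} (h : p ∈ field L) {ε : ℝ} (hε : 0 ≤ ε) :
    raise p ε ∈ field L :=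
  ⟨h.1, h.2.1, add_nonneg h.2.2 hε⟩

theorem continuous_raise (p : Point) : Continuous (raise p) := by
  unfold raise
  fun_prop

theorem lt_gap_raise_left {L : ℝ} {e : Point} (h : e ∈ field L) (p : Point) (s : ℝ) {ε : ℝ}
    (hε : 0 < ε) : gap e p s < gap (raise e ε) p s := by
  have := h.2.2
  simp only [gap, raise]
  nlinarith

theorem gap_raise_right_lt {L : ℝ} {p : Point} (h : p ∈ field L) (e : Point) (s : ℝ) {ε : ℝ}
    (hε : 0 < ε) : gap e (raise p ε) s < gap e p s := by
  have := h.2.2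
  simp only [gap, raise]
  nlinarith

theorem mem_closure_of_path {X : Type*} [TopologicalSpace X] {c : ℝ → X} (hc : Continuous c)
    {S : Set X} (h : ∀ ε, 0 < ε → c ε ∈ S) : c 0 ∈ closure S := by
  have h0 : (0 : ℝ) ∈ closure (Ioi (0 : ℝ)) := by simp
  exact closure_mono (image_subset_iff.2 fun ε hε => h ε hε)
    (image_closure_subset_closure_image hc ⟨0, h0, rfl⟩)

/-- Raising the evader strictly increases every gap. The absolute value of `ε` keeps the path on the
field for all real `ε`. -/
theorem mem_closure_guardedStates {L : ℝ} (w : stateSpace L) (h : w.1 ∉ unguardedStates L) :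
    w ∈ closure (Subtype.val ⁻¹' guardedStates L : Set (stateSpace L)) := by
  obtain ⟨⟨e, p₁, p₂⟩, he, h₁, h₂⟩ := w
  have hc : Continuous fun ε : ℝ => (⟨(raise e |ε|, p₁, p₂),
      raise_mem_field he (abs_nonneg ε), h₁, h₂⟩ : stateSpace L) :=
    Continuous.subtype_mk (((continuous_raise e).comp continuous_abs).prodMk continuous_const) _
  convert! mem_closure_of_path hc (S := Subtype.val ⁻¹' guardedStates L) ?_ using 1
  · simp [raise]
  · intro ε hε s hs
    have hgap : 0 ≤ gap e p₁ s ∨ 0 ≤ gap e p₂ s := by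
      by_contra! hlt
      exact h ⟨s, hs, hlt⟩
    exact hgap.imp (lt_gap_raise_left he p₁ s (abs_pos.2 hε.ne')).trans_le'
      (lt_gap_raise_left he p₂ s (abs_pos.2 hε.ne')).trans_le'

/-- Lowering the evader could leave the field, so both pursuers are raised instead, which strictly
decreases every gap. -/
theorem mem_closure_unguardedStates {L : ℝ} (w : stateSpace L) (h : w.1 ∉ guardedStates L) :
    w ∈ closure (Subtype.val ⁻¹' unguardedStates L : Set (stateSpace L)) := by
  obtain ⟨⟨e, p₁, p₂⟩, he, h₁, h₂⟩ := w
  have hc : Continuous fun ε : ℝ => (⟨(e, raise p₁ |ε|, raise p₂ |ε|),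
      he, raise_mem_field h₁ (abs_nonneg ε), raise_mem_field h₂ (abs_nonneg ε)⟩ : stateSpace L) :=
    Continuous.subtype_mk (continuous_const.prodMk
      (((continuous_raise p₁).comp continuous_abs).prodMk
        ((continuous_raise p₂).comp continuous_abs))) _
  convert! mem_closure_of_path hc (S := Subtype.val ⁻¹' unguardedStates L) ?_ using 1
  · simp [raise]
  · intro ε hε
    simp only [guardedStates, mem_ofPred_eq, not_forall, not_or, not_lt] at h
    obtain ⟨s, hs, hgap₁, hgap₂⟩ := h
    exact ⟨s, hs, (gap_raise_right_lt h₁ e s (abs_pos.2 hε.ne')).trans_le hgap₁,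
      (gap_raise_right_lt h₂ e s (abs_pos.2 hε.ne')).trans_le hgap₂⟩

theorem mem_barrier_iff {v L : ℝ} (hv : 0 < v) {w : State} :
    w ∈ barrier v v v L ↔ w ∈ stateSpace L ∧ w ∉ unguardedStates L ∧ w ∉ guardedStates L := by
  set U : Set (stateSpace L) := Subtype.val ⁻¹' unguardedStates L with hU
  set G : Set (stateSpace L) := Subtype.val ⁻¹' guardedStates L with hG
  set R : Set (stateSpace L) := Subtype.val ⁻¹' evaderWinSet v v v L with hR
  set Q : Set (stateSpace L) := Subtype.val ⁻¹' pursuerWinSet v v v L with hQ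
  have hUR : U ⊆ R := fun w hw => unguardedStates_subset_evaderWinSet hv w.2 hw
  have hGQ : G ⊆ Q := fun w hw => guardedStates_subset_pursuerWinSet w.2 hw
  have hUo : IsOpen U := (isOpen_unguardedStates L).preimage continuous_subtype_val
  have hGo : IsOpen G := (isOpen_guardedStates L).preimage continuous_subtype_val
  have hRQ : Disjoint R Q := (disjoint_winSets v v v L).preimage _
  constructor
  · rintro ⟨h, hfR, hfQ⟩
    exact ⟨h, fun hu => hfR.2 (interior_maximal hUR hUo hu),
      fun hg => hfQ.2 (interior_maximal hGQ hGo hg)⟩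
  · rintro ⟨h, hu, hg⟩
    have hcU := closure_mono hUR (mem_closure_unguardedStates ⟨w, h⟩ hg)
    have hcG := closure_mono hGQ (mem_closure_guardedStates ⟨w, h⟩ hu)
    rw [barrier]
    refine ⟨h, ?_, ?_⟩ <;> rw [frontier_eq_closure_inter_closure]
    · exact ⟨hcU, closure_mono hRQ.subset_compl_left hcG⟩
    · exact ⟨hcG, closure_mono hRQ.subset_compl_right hcU⟩

/-! ### Minimizing the larger gap along the goal line -/

/-- If the larger of the two gaps is smallest at the point `(m, 0)` of the goal line, then the
winner is decided by the larger gap there. -/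
theorem not_unguarded_and_not_guarded_iff {L m c : ℝ} {w : State} (hm : m ∈ Icc 0 L)
    (h₁ : gap w.1 w.2.1 m ≤ c) (h₂ : gap w.1 w.2.2 m ≤ c)
    (hmin : ∀ s ∈ Icc 0 L, c ≤ gap w.1 w.2.1 s ∨ c ≤ gap w.1 w.2.2 s) :
    w ∉ unguardedStates L ∧ w ∉ guardedStates L ↔ c = 0 := by
  constructor
  · rintro ⟨hu, hg⟩
    apply le_antisymm
    · by_contra! hc
      exact hg fun s hs => (hmin s hs).imp hc.trans_le hc.trans_le
    · by_contra! hc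
      exact hu ⟨m, hm, h₁.trans_lt hc, h₂.trans_lt hc⟩
  · rintro rfl
    refine ⟨?_, fun hg => (hg m hm).elim h₁.not_gt h₂.not_gt⟩
    rintro ⟨s, hs, hs₁, hs₂⟩
    exact (hmin s hs).elim hs₁.not_ge hs₂.not_ge

/-- The evader's distance cancels, so the first gap is the larger one to the left of `xI` and the
second to the right. -/
theorem gap_sub_gap {p₁ p₂ : Point} (h : p₁.1 < p₂.1) (e : Point) (s : ℝ) :
    gap e p₁ s - gap e p₂ s = 2 * (p₂.1 - p₁.1) * (xI p₁ p₂ - s) := by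
  have : p₂.1 - p₁.1 ≠ 0 := by linarith
  unfold gap xI
  field_simp
  ring

theorem gap_sub_gap_self (e p : Point) (s m : ℝ) :
    gap e p s - gap e p m = 2 * (e.1 - p.1) * (m - s) := by
  unfold gap
  ring

end FootballGame

theorem corollary1 (v L x₁ y₁ x₂ y₂ : ℝ) (hv : 0 < v)
    (hP₁ : (x₁, y₁) ∈ FootballGame.field L) (hP₂ : (x₂, y₂) ∈ FootballGame.field L)
    (hx : x₁ < x₂)
    (hI : (FootballGame.xI (x₁, y₁) (x₂, y₂), (0 : ℝ)) ∈ FootballGame.goalLine L) :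
    FootballGame.barrierCrossSection v v v L (x₁, y₁) (x₂, y₂) =
      {p | p ∈ FootballGame.field L ∧
        ((p.1 ≤ x₁ ∧ p.1 ^ 2 + p.2 ^ 2 = x₁ ^ 2 + y₁ ^ 2) ∨
         (x₁ < p.1 ∧ p.1 < x₂ ∧
            (p.1 - FootballGame.xI (x₁, y₁) (x₂, y₂)) ^ 2 + p.2 ^ 2 =
              (x₁ - FootballGame.xI (x₁, y₁) (x₂, y₂)) ^ 2 + y₁ ^ 2) ∨
         (x₂ ≤ p.1 ∧ (p.1 - L) ^ 2 + p.2 ^ 2 = (x₂ - L) ^ 2 + y₂ ^ 2))} := by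
  ext e
  obtain ⟨⟨hI0, hIL, -⟩, -⟩ := hI
  simp only at hI0 hIL
  have hd := FootballGame.gap_sub_gap (p₁ := (x₁, y₁)) (p₂ := (x₂, y₂)) hx e
  have hd₁ := FootballGame.gap_sub_gap_self e (x₁, y₁)
  have hd₂ := FootballGame.gap_sub_gap_self e (x₂, y₂)
  simp only at hd hd₁ hd₂
  set m := FootballGame.xI (x₁, y₁) (x₂, y₂)
  have hL : 0 ≤ L := hI0.trans hIL
  have hx' : 0 < x₂ - x₁ := sub_pos.2 hx
  rw [FootballGame.barrierCrossSection, Set.mem_ofPred_eq, FootballGame.mem_barrier_iff hv,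
    Set.mem_ofPred_eq]
  refine and_congr ⟨fun h => h.1, fun h => ⟨h, hP₁, hP₂⟩⟩ ?_
  -- Evader left of both pursuers: neither gap decreases with `s`, so the minimum is at 0, where the
  -- first gap is the larger because `0 ≤ m`.
  rcases le_or_gt e.1 x₁ with h₁ | h₁
  · rw [FootballGame.not_unguarded_and_not_guarded_iff (m := 0)
      (c := FootballGame.gap e (x₁, y₁) 0) ⟨le_rfl, hL⟩ le_rfl]
    · have : ¬ x₂ ≤ e.1 := by linarith
      simp [h₁, h₁.not_gt, this, FootballGame.gap, sub_eq_zero]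
    · nlinarith [hd 0]
    · exact fun s hs => Or.inl (by nlinarith [hd₁ s 0, hs.1])
  -- Evader between them: the first gap decreases and the second increases with `s`, so the minimum
  -- is where they are equal, at `m`.
  rcases lt_or_ge e.1 x₂ with h₂ | h₂
  · have heq := hd m
    rw [sub_self, mul_zero] at heq
    rw [FootballGame.not_unguarded_and_not_guarded_iff (m := m)
      (c := FootballGame.gap e (x₁, y₁) m) ⟨hI0, hIL⟩ le_rfl]
    · simp [h₁, h₁.not_ge, h₂, h₂.not_ge, FootballGame.gap, sub_eq_zero]
    · simp only
      linarith
    · intro s _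
      rcases le_total s m with hs | hs
      · exact Or.inl (by nlinarith [hd₁ s m])
      · exact Or.inr (by simp only; nlinarith [hd₂ s m])
  -- Evader not left of the second pursuer: neither gap increases with `s`, so the minimum is at
  -- `L`, where the second gap is the larger because `m ≤ L`.
  · rw [FootballGame.not_unguarded_and_not_guarded_iff (m := L)
      (c := FootballGame.gap e (x₂, y₂) L) ⟨hL, le_rfl⟩ ?_ le_rfl]
    · simp [h₁, h₁.not_ge, h₂, h₂.not_gt, FootballGame.gap, sub_eq_zero]
    · exact fun s hs => Or.inr (by nlinarith [hd₂ s L, hs.2])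
    · simp only
      nlinarith [hd L]
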